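/- All Lie algebras are over $\mathbb{C}$. Let $n=2d+1>3$ be odd, and let $Q_n$ be the $(n+1)$-dimensional Lie algebra with basis $x_0,\dots,x_n$ and brackets $$[x_0,x_i]=x_{i+1},\qquad [x_i,x_{n-i}]=(-1)^i x_n,\qquad 1\le i\le n-1,$$ all other brackets of basis vectors being zero or obtained by antisymmetry. Put $e_0=x_0+x_1$ and $e_k=x_k$ for $1\le k\le n$; this is another basis of $Q_n$. A *quasi $Q_n$-filiform Lie algebra* is a Lie algebra $N=N_1+\cdots+N_m$ (a sum of subalgebras, not necessarily direct) with $N_i\cong Q_n$ for all $i$ and $[N_i,N_j]=0$ for $i\ne j$. It is denoted $N(Q_n,m,r)$, where $r=\dim c^{n-1}N$ and $c^0N=N$, $c^{k}N=[N,c^{k-1}N]$. Given such a decomposition and isomorphisms $Q_n\cong N_i$, let $e_{i0},\dots,e_{in}$ be the basis of $N_i$ corresponding to $e_0,\dots,e_n$. An $(m-r)\times m$ block matrix $(A\ \ I_{m-r})$ with complex entries is called a *related matrix* of $N=N(Q_n,m,r)$ if, for some choice of the decomposition (with its summands in some order) and of the isomorphisms, $$(A\ \ I_{m-r})\,(e_{1n}\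 \ e_{2n}\ \cdots\ e_{mn})^{t}=0 .$$ A square matrix is *monomial* if each row and each column has exactly one nonzero entry. **Theorem 3.1.** Let $\mathcal N_1$ and $\mathcal N_2$ be quasi $Q_n$-filiform Lie algebras, both of type $N(Q_n,m,r)$ with the same $n,m,r$, and let $(A_i\ \ I_{m-r})$ be a related matrix of $\mathcal N_i$ for $i=1,2$. Then $\mathcal N_1\cong \mathcal N_2$ as Lie algebras if and only if there exist an invertible complex $(m-r)\times(m-r)$ matrix $E$ and a monomial complex $m\times m$ matrix $K$ such that $$E\,(A_1\ \ I_{m-r})\,K=(A_2\ \ I_{m-r}).$$ -/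

import Mathlib

/-- The underlying space of the filiform Lie algebra `Q_n`, `n = 2 d + 1`: coordinate vectors
with respect to the basis `x_0, …, x_n`. -/
def QLie (d : ℕ) : Type := Fin (2 * d + 2) → ℂ

namespace QLie

noncomputable instance (d : ℕ) : AddCommGroup (QLie d) :=
  inferInstanceAs (AddCommGroup (Fin (2 * d + 2) → ℂ))

noncomputable instance (d : ℕ) : Module ℂ (QLie d) :=
  inferInstanceAs (Module ℂ (Fin (2 * d + 2) → ℂ))

/-- The coordinate vector of an element. -/
def coord {d : ℕ} (f : QLie d) : Fin (2 * d + 2) → ℂ := f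

/-- The basis vector `x_k`, `0 ≤ k ≤ n`. -/
noncomputable def x (d : ℕ) (k : Fin (2 * d + 2)) : QLie d :=
  (Pi.single k 1 : Fin (2 * d + 2) → ℂ)

/-- For `j = 0, …, n - 2`, the index `i = j + 1` in `{1, …, n - 1}`.
Then `x_{i+1}` is `x d j.succ.succ` and `x_{n-i}` is `x d (mid j.rev)`. -/
def mid {d : ℕ} (j : Fin (2 * d)) : Fin (2 * d + 2) := j.succ.castSucc

/-- The bilinear antisymmetric bracket determined by
`[x_0, x_i] = x_{i+1}` and `[x_i, x_{n-i}] = (-1)^i x_n` for `1 ≤ i ≤ n - 1`,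
all other brackets of basis vectors being zero or obtained by antisymmetry.
(Here `i = j + 1`; for odd `n` the second family is already antisymmetric.) -/
noncomputable instance (d : ℕ) : Bracket (QLie d) (QLie d) where
  bracket f g :=
    (∑ j : Fin (2 * d), (f.coord 0 * g.coord (mid j) - f.coord (mid j) * g.coord 0) •
        x d j.succ.succ) +
      (∑ j : Fin (2 * d), (-1 : ℂ) ^ ((j : ℕ) + 1) * f.coord (mid j) * g.coord (mid j.rev)) •
        x d (Fin.last (2 * d + 1))

theorem bracket_def {d : ℕ} (f g : QLie d) : ⁅f, g⁆ =
    (∑ j : Fin (2 * d), (f.coord 0 * g.coord (mid j) - f.coord (mid j) * g.coord 0) •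
        x d j.succ.succ) +
      (∑ j : Fin (2 * d), (-1 : ℂ) ^ ((j : ℕ) + 1) * f.coord (mid j) * g.coord (mid j.rev)) •
        x d (Fin.last (2 * d + 1)) := rfl

@[simp] theorem add_coord {d : ℕ} (f g : QLie d) (k : Fin (2 * d + 2)) :
    (f + g).coord k = f.coord k + g.coord k := rfl

@[simp] theorem smul_coord {d : ℕ} (c : ℂ) (f : QLie d) (k : Fin (2 * d + 2)) :
    (c • f).coord k = c * f.coord k := rfl

@[simp] theorem neg_coord {d : ℕ} (f : QLie d) (k : Fin (2 * d + 2)) :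
    (-f).coord k = -f.coord k := rfl

@[simp] theorem zero_coord {d : ℕ} (k : Fin (2 * d + 2)) : (0 : QLie d).coord k = 0 := rfl

theorem x_coord {d : ℕ} (i k : Fin (2 * d + 2)) : (x d i).coord k = if k = i then 1 else 0 := by
  simp [x, coord, Pi.single_apply]

theorem sum_coord {d : ℕ} {ι : Type} (s : Finset ι) (F : ι → QLie d) (k : Fin (2 * d + 2)) :
    (∑ i ∈ s, F i).coord k = ∑ i ∈ s, (F i).coord k :=
  Finset.sum_apply k s (fun i => (F i : Fin (2 * d + 2) → ℂ))

theorem bracket_zero {d : ℕ} (f g : QLie d) : ⁅f, g⁆.coord 0 = 0 := by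
  rw [bracket_def, add_coord, sum_coord, smul_coord, x_coord, if_neg (by simp [Fin.ext_iff]),
    mul_zero, add_zero]
  refine Finset.sum_eq_zero fun j _ => ?_
  rw [smul_coord, x_coord, if_neg (by simp [Fin.ext_iff]), mul_zero]

theorem bracket_one {d : ℕ} (f g : QLie d) : ⁅f, g⁆.coord 1 = 0 := by
  rcases Nat.eq_zero_or_pos d with rfl | hd
  · simp [bracket_def]
  rw [bracket_def, add_coord, sum_coord, smul_coord, x_coord,
    if_neg (by simp [Fin.ext_iff]; omega), mul_zero, add_zero]
  refine Finset.sum_eq_zero fun j _ => ?_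
  rw [smul_coord, x_coord, if_neg (by simp [Fin.ext_iff]), mul_zero]

theorem bracket_succ_succ {d : ℕ} (f g : QLie d) (j : Fin (2 * d)) :
    ⁅f, g⁆.coord j.succ.succ = (f.coord 0 * g.coord (mid j) - f.coord (mid j) * g.coord 0) +
      if (j : ℕ) + 1 = 2 * d then
        ∑ j : Fin (2 * d), (-1 : ℂ) ^ ((j : ℕ) + 1) * f.coord (mid j) * g.coord (mid j.rev) else 0 := by
  rw [bracket_def, add_coord, sum_coord, smul_coord, x_coord]
  congr 1
  · rw [Finset.sum_eq_single j]
    · simp [x_coord]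
    · intro b _ hb
      simp [x_coord, hb.symm]
    · simp
  · simp [Fin.ext_iff]

theorem ext_coord {d : ℕ} {f g : QLie d} (h0 : f.coord 0 = g.coord 0) (h1 : f.coord 1 = g.coord 1)
    (h : ∀ j : Fin (2 * d), f.coord j.succ.succ = g.coord j.succ.succ) : f = g := by
  refine funext fun k => ?_
  refine Fin.cases h0 (fun k => ?_) k
  refine Fin.cases h1 (fun k => h k) k

theorem sum_rev_symm {d : ℕ} (f g : QLie d) :
    ∑ j : Fin (2 * d), (-1 : ℂ) ^ ((j : ℕ) + 1) * f.coord (mid j) * g.coord (mid j.rev) =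
      - ∑ j : Fin (2 * d), (-1 : ℂ) ^ ((j : ℕ) + 1) * g.coord (mid j) * f.coord (mid j.rev) := by
  rw [← Equiv.sum_comp Fin.revPerm, ← Finset.sum_neg_distrib]
  refine Finset.sum_congr rfl fun j _ => ?_
  have : (-1 : ℂ) ^ ((j.rev : ℕ) + 1) = - (-1 : ℂ) ^ ((j : ℕ) + 1) := by
    have h : (j.rev : ℕ) + 1 + ((j : ℕ) + 1) = 2 * d + 1 := by
      rw [Fin.val_rev]; omega
    have h2 : (-1 : ℂ) ^ ((j.rev : ℕ) + 1) * (-1 : ℂ) ^ ((j : ℕ) + 1) = -1 := by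
      rw [← pow_add, h]; simp [pow_succ, pow_mul]
    have h3 : (-1 : ℂ) ^ ((j : ℕ) + 1) * (-1 : ℂ) ^ ((j : ℕ) + 1) = 1 := by
      rw [← mul_pow]; simp
    linear_combination (-1 : ℂ) ^ ((j : ℕ) + 1) * h2 - (-1 : ℂ) ^ ((j.rev : ℕ) + 1) * h3
  simp only [Fin.revPerm_apply, Fin.rev_rev, this]
  ring

theorem bracket_mid {d : ℕ} (g h : QLie d) (j : Fin (2 * d)) :
    ⁅g, h⁆.coord (mid j) =
      g.coord 0 * (∑ k : Fin (2 * d), if (k : ℕ) + 1 = j then h.coord (mid k) else 0) -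
      h.coord 0 * (∑ k : Fin (2 * d), if (k : ℕ) + 1 = j then g.coord (mid k) else 0) := by
  obtain ⟨j, hj⟩ := j
  cases j with
  | zero =>
    have : mid (⟨0, hj⟩ : Fin (2 * d)) = 1 := by simp [mid]
    rw [this, bracket_one]
    simp
  | succ i =>
    have hi : i < 2 * d := by omega
    have : mid (⟨i + 1, hj⟩ : Fin (2 * d)) = (⟨i, hi⟩ : Fin (2 * d)).succ.succ := by
      simp [mid]
    rw [this, bracket_succ_succ, if_neg (by simp only []; omega),
      Finset.sum_eq_single (⟨i, hi⟩ : Fin (2 * d)), Finset.sum_eq_single (⟨i, hi⟩ : Fin (2 * d))]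
    · simp; ring
    all_goals simp +contextual [Fin.ext_iff]

theorem sum_shift_symm {d : ℕ} (f h : QLie d) :
    ∑ j : Fin (2 * d), (-1 : ℂ) ^ ((j : ℕ) + 1) * f.coord (mid j) *
        (∑ k : Fin (2 * d), if (k : ℕ) + 1 = j.rev then h.coord (mid k) else 0) =
      ∑ j : Fin (2 * d), (-1 : ℂ) ^ ((j : ℕ) + 1) * h.coord (mid j) *
        (∑ k : Fin (2 * d), if (k : ℕ) + 1 = j.rev then f.coord (mid k) else 0) := by
  simp only [Finset.mul_sum]
  rw [Finset.sum_comm]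
  refine Finset.sum_congr rfl fun j _ => Finset.sum_congr rfl fun k _ => ?_
  by_cases hjk : (j : ℕ) + k + 2 = 2 * d
  · have e : (-1 : ℂ) ^ ((k : ℕ) + 1) = (-1 : ℂ) ^ ((j : ℕ) + 1) := by
      rcases neg_one_pow_eq_or ℂ ((j : ℕ) + 1) with h1 | h1 <;>
        rcases neg_one_pow_eq_or ℂ ((k : ℕ) + 1) with h2 | h2
      all_goals first
        | (rw [h1, h2]; done)
        | (exfalso
           have h3 : (-1 : ℂ) ^ ((j : ℕ) + 1 + ((k : ℕ) + 1)) = 1 := by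
             rw [show (j : ℕ) + 1 + ((k : ℕ) + 1) = 2 * d by omega]; simp
           rw [pow_add, h1, h2] at h3
           norm_num at h3)
    rw [if_pos (by rw [Fin.val_rev]; omega), if_pos (by rw [Fin.val_rev]; omega), e]
    ring
  · rw [if_neg (by rw [Fin.val_rev]; omega), if_neg (by rw [Fin.val_rev]; omega)]
    simp

theorem sum_bracket {d : ℕ} (f g h : QLie d) :
    ∑ j : Fin (2 * d), (-1 : ℂ) ^ ((j : ℕ) + 1) * f.coord (mid j) * ⁅g, h⁆.coord (mid j.rev) =
      g.coord 0 * (∑ j : Fin (2 * d), (-1 : ℂ) ^ ((j : ℕ) + 1) * f.coord (mid j) *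
        (∑ k : Fin (2 * d), if (k : ℕ) + 1 = j.rev then h.coord (mid k) else 0)) -
      h.coord 0 * (∑ j : Fin (2 * d), (-1 : ℂ) ^ ((j : ℕ) + 1) * f.coord (mid j) *
        (∑ k : Fin (2 * d), if (k : ℕ) + 1 = j.rev then g.coord (mid k) else 0)) := by
  rw [Finset.mul_sum (a := g.coord 0), Finset.mul_sum (a := h.coord 0), ← Finset.sum_sub_distrib]
  refine Finset.sum_congr rfl fun j _ => ?_
  rw [bracket_mid]
  ring

theorem bracket_skew {d : ℕ} (f g : QLie d) : ⁅f, g⁆ = -⁅g, f⁆ := by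
  refine ext_coord ?_ ?_ fun j => ?_
  · rw [bracket_zero, neg_coord, bracket_zero,
      neg_zero]
  · rw [bracket_one, neg_coord, bracket_one,
      neg_zero]
  · rw [bracket_succ_succ,
      neg_coord,
      bracket_succ_succ, sum_rev_symm f g]
    split_ifs <;> ring

theorem bracket_add {d : ℕ} (f g h : QLie d) : ⁅f, g + h⁆ = ⁅f, g⁆ + ⁅f, h⁆ := by
  refine ext_coord ?_ ?_ fun j => ?_
  · simp [bracket_zero]
  · simp [bracket_one]
  · simp only [bracket_succ_succ, add_coord, mul_add, Finset.sum_add_distrib]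
    split_ifs <;> ring

theorem bracket_smul {d : ℕ} (c : ℂ) (f g : QLie d) : ⁅f, c • g⁆ = c • ⁅f, g⁆ := by
  refine ext_coord ?_ ?_ fun j => ?_
  · simp [bracket_zero]
  · simp [bracket_one]
  · simp only [bracket_succ_succ, smul_coord]
    rw [mul_add, mul_ite, Finset.mul_sum]
    congr 1
    · ring
    · refine if_congr Iff.rfl (Finset.sum_congr rfl fun _ _ => by ring) (by simp)

theorem jacobi {d : ℕ} (f g h : QLie d) : ⁅f, ⁅g, h⁆⁆ = ⁅⁅f, g⁆, h⁆ + ⁅g, ⁅f, h⁆⁆ := by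
  rw [bracket_skew ⁅f, g⁆ h]
  refine ext_coord ?_ ?_ fun j => ?_
  · rw [add_coord, neg_coord]
    simp [bracket_zero]
  · rw [add_coord, neg_coord]
    simp [bracket_one]
  · rw [add_coord, neg_coord]
    simp only [bracket_succ_succ, sum_bracket]
    simp only [bracket_zero, bracket_mid]
    rw [sum_shift_symm h g, sum_shift_symm h f, sum_shift_symm g f]
    split_ifs <;> ring

noncomputable instance (d : ℕ) : LieRing (QLie d) where
  add_lie f g h := by
    rw [bracket_skew, bracket_add, bracket_skew h f, bracket_skew h g]; abel
  lie_add := bracket_add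
  lie_self f := by
    have h : (2 : ℂ) • ⁅f, f⁆ = 0 := by
      rw [two_smul]; nth_rewrite 1 [bracket_skew]; exact neg_add_cancel _
    exact (smul_eq_zero.mp h).resolve_left two_ne_zero
  leibniz_lie := jacobi

noncomputable instance (d : ℕ) : LieAlgebra ℂ (QLie d) where
  lie_smul := bracket_smul

/-- The second basis of `Q_n`: `e_0 = x_0 + x_1` and `e_k = x_k` for `1 ≤ k ≤ n`. -/
noncomputable def e (d : ℕ) (k : Fin (2 * d + 2)) : QLie d :=
  if k = 0 then x d 0 + x d 1 else x d k

end QLie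

/-- A decomposition `N = N_1 + ⋯ + N_m` (the sum need not be direct) into pairwise commuting
subalgebras isomorphic to `Q_n`, `n = 2 d + 1`, with chosen isomorphisms `Q_n ≅ N_i`. -/
structure QDecomposition (d m : ℕ) (N : Type*) [LieRing N] [LieAlgebra ℂ N] where
  comp : Fin m → LieSubalgebra ℂ N
  iso : ∀ i, QLie d ≃ₗ⁅ℂ⁆ comp i
  iSup_comp : ⨆ i, (comp i).toSubmodule = ⊤
  comm : ∀ i j, i ≠ j → ∀ x ∈ comp i, ∀ y ∈ comp j, ⁅x, y⁆ = 0

/-- The element `e_{ik}` of `N`: the `k`-th vector of the basis `e_{i0}, …, e_{in}` of `N_i`.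
A choice of the isomorphisms `Q_n ≅ N_i` is the same as a choice of such bases, and each is
determined by the generators `e_{i0}, e_{i1}` of `N_i`. -/
noncomputable def QDecomposition.e {d m : ℕ} {N : Type*} [LieRing N] [LieAlgebra ℂ N]
    (D : QDecomposition d m N) (i : Fin m) (k : Fin (2 * d + 2)) : N :=
  (D.iso i (QLie.e d k) : N)

/-- `N` is a quasi `Q_n`-filiform Lie algebra `N(Q_n, m, r)`, `n = 2 d + 1`, where
`r = dim c^{n-1} N` with `c^0 N = N`, `c^{k+1} N = [N, c^k N]`. -/
def IsQuasiQFiliform (d m r : ℕ) (N : Type*) [LieRing N] [LieAlgebra ℂ N] : Prop :=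
  Nonempty (QDecomposition d m N) ∧
    Module.finrank ℂ (LieModule.lowerCentralSeries ℂ N N (2 * d)) = r

/-- The `(m - r) × m` block matrix `(A  I_{m-r})`. -/
def blockMatrix {m r : ℕ} (A : Matrix (Fin (m - r)) (Fin r) ℂ) :
    Matrix (Fin (m - r)) (Fin m) ℂ :=
  Matrix.of fun i j =>
    if h : (j : ℕ) < r then A i ⟨j, h⟩ else if (j : ℕ) = r + i then 1 else 0

/-- `(A  I_{m-r})` is a related matrix of `N = N(Q_n, m, r)`: for some decomposition and some
choice of the bases `e_{i0}, …, e_{in}` of the summands,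
`(A  I_{m-r}) (e_{1n}, …, e_{mn})ᵗ = 0`. -/
def IsRelatedMatrix (d : ℕ) {m r : ℕ} (N : Type*) [LieRing N] [LieAlgebra ℂ N]
    (A : Matrix (Fin (m - r)) (Fin r) ℂ) : Prop :=
  ∃ D : QDecomposition d m N, ∀ i : Fin (m - r),
    ∑ j : Fin m, blockMatrix A i j • D.e j (Fin.last (2 * d + 1)) = 0

/-- Each row and each column has exactly one nonzero entry. -/
def IsMonomialMatrix {m : ℕ} (K : Matrix (Fin m) (Fin m) ℂ) : Prop :=
  (∀ i, ∃! j, K i j ≠ 0) ∧ ∀ j, ∃! i, K i j ≠ 0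

/-! A quasi `Q_n`-filiform algebra is a quotient of `Q_n^m` by a central subspace, so it is
determined by the linear relations among the central elements `e_{in}`. Those elements span `c^{n-1}
N`, which has dimension `r`; hence the rows of a related matrix form a basis of the relations.
Everything reduces to the lines spanned by the `e_{in}`.

These lines are intrinsic up to permutation. Modulo the centre, `(ad y)^(n-2)` acts on the `k`-th
summand with rank one if `y_k` has nonzero `x_0`-coordinate, and as zero otherwise; here `n > 3`
matters. The `x_0` of one summand gives rank one, so in any other decomposition it has a nonzero
`x_0`-coordinate in exactly one summand. The image is the line of `x_{n-1}` modulo the centre, and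
one more bracket with `x_0` reaches `x_n` (`exists_smul_last`, `exists_perm_smul_last`). An
isomorphism is handled by composing one cover with it, which gives two covers of the same algebra.
The permutation and scalars form `K`, and comparing relation spaces gives `E`.

Conversely, `K` permutes the lines and rescales them. The rescaling lifts to `Q_n^m` because `x_n`
can be multiplied by any nonzero scalar through a diagonal automorphism; the lift matches the
kernels (`IsQCover.nonempty_lieEquiv`). -/

namespace QLie

/-! ### The coordinate filtration, powers of `ad` and diagonal maps of `Q_n`. -/

variable {d : ℕ}

/-- The subspace of the elements whose coordinates of index `< k` vanish. -/
def tail (d k : ℕ) : Submodule ℂ (QLie d) where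
  carrier := {f | ∀ j : Fin (2 * d + 2), (j : ℕ) < k → f.coord j = 0}
  add_mem' hf hg j hj := by rw [add_coord, hf j hj, hg j hj, add_zero]
  zero_mem' _ _ := rfl
  smul_mem' c f hf j hj := by rw [smul_coord, hf j hj, mul_zero]

theorem mem_tail {k : ℕ} {f : QLie d} :
    f ∈ tail d k ↔ ∀ j : Fin (2 * d + 2), (j : ℕ) < k → f.coord j = 0 := Iff.rfl

theorem coord_injective {f g : QLie d} (h : ∀ k, f.coord k = g.coord k) : f = g := funext h

theorem val_mid (j : Fin (2 * d)) : ((mid j : Fin (2 * d + 2)) : ℕ) = j + 1 := by simp [mid]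

theorem lie_mem_tail_two (g f : QLie d) : ⁅g, f⁆ ∈ tail d 2 := by
  intro j hj
  induction j using Fin.cases with
  | zero => exact bracket_zero g f
  | succ j =>
    induction j using Fin.cases with
    | zero => exact bracket_one g f
    | succ j => simp at hj

theorem lie_mem_tail_succ {k : ℕ} {f : QLie d} (hf : f ∈ tail d k) (g : QLie d) :
    ⁅g, f⁆ ∈ tail d (k + 1) := by
  intro j hj
  induction j using Fin.cases with
  | zero => exact bracket_zero g f
  | succ j =>
    induction j using Fin.cases with
    | zero => exact bracket_one g f
    | succ j =>
      simp only [Fin.val_succ] at hj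
      rw [bracket_succ_succ, hf (mid j) (by rw [val_mid]; omega), hf 0 (by simp; omega)]
      split_ifs with h
      · rw [Finset.sum_eq_zero fun i _ => ?_]
        · ring
        · rw [hf (mid i.rev) (by rw [val_mid]; omega), mul_zero]
      · ring

theorem mem_tail_top {f : QLie d} :
    f ∈ tail d (2 * d + 1) ↔ f = f.coord (Fin.last _) • x d (Fin.last _) := by
  refine ⟨fun h => coord_injective fun k => ?_, fun h => ?_⟩
  · rw [smul_coord, x_coord]
    split_ifs with hk
    · rw [hk, mul_one]
    · rw [h k (by have := k.isLt; rw [Fin.ext_iff, Fin.val_last] at hk; omega), mul_zero]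
  · rw [h]
    intro j hj
    rw [smul_coord, x_coord, if_neg (by rintro rfl; simp at hj), mul_zero]

theorem eq_zero_of_mem_tail {f : QLie d} (h : f ∈ tail d (2 * d + 2)) : f = 0 :=
  coord_injective fun k => h k k.isLt

theorem lie_eq_zero_of_mem_tail {f : QLie d} (h : f ∈ tail d (2 * d + 1)) (g : QLie d) :
    ⁅g, f⁆ = 0 := eq_zero_of_mem_tail (lie_mem_tail_succ h g)

theorem x_zero_lie (f : QLie d) (j : Fin (2 * d)) :
    ⁅x d 0, f⁆.coord j.succ.succ = f.coord (mid j) := by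
  have h (j : Fin (2 * d)) : (x d 0).coord (mid j) = 0 := by
    rw [x_coord, if_neg]; simp [Fin.ext_iff, val_mid]
  rw [bracket_succ_succ, h]
  simp [h, x_coord]

theorem x_zero_lie_x {k l : Fin (2 * d + 2)} (hk : k ≠ 0) (h : (l : ℕ) = k + 1) :
    ⁅x d 0, x d k⁆ = x d l := by
  have hk' : (k : ℕ) ≠ 0 := fun h => hk (Fin.ext h)
  refine ext_coord ?_ ?_ fun j => ?_
  · rw [bracket_zero, x_coord, if_neg]; simp [Fin.ext_iff]; omega
  · rw [bracket_one, x_coord, if_neg]; simp [Fin.ext_iff]; omega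
  · rw [x_zero_lie, x_coord, x_coord]
    refine if_congr ?_ rfl rfl
    simp only [Fin.ext_iff, val_mid, Fin.val_succ]; omega

/-- The centre of `Q_n` is spanned by `x_n`. -/
theorem mem_tail_of_lie_eq_zero (hd : 1 ≤ d) {f : QLie d} (h : ∀ g : QLie d, ⁅g, f⁆ = 0) :
    f ∈ tail d (2 * d + 1) := by
  -- Bracketing with `x_0` kills the coordinates `1, …, n - 1`; bracketing with `x_1` then kills
  -- coordinate `0`.
  have hmid (j : Fin (2 * d)) : f.coord (mid j) = 0 := by
    rw [← x_zero_lie, h, zero_coord]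
  intro j hj
  induction j using Fin.cases with
  | zero =>
    have h1 := congrArg (fun q => q.coord (⟨0, by omega⟩ : Fin (2 * d)).succ.succ) (h (x d 1))
    simp only [bracket_succ_succ, zero_coord, hmid] at h1
    simpa [x_coord, mid, Fin.ext_iff] using h1
  | succ j =>
    simp only [Fin.val_succ] at hj
    have := hmid ⟨j, by omega⟩
    convert this using 2
    ext; simp [mid]

/-- The leading coordinate of `(ad f)^(k+1) g`. -/
theorem ad_pow (f g : QLie d) (k : ℕ) :
    ((fun z => ⁅f, z⁆)^[k + 1] g) ∈ tail d (k + 2) ∧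
      ∀ j : Fin (2 * d + 2), (j : ℕ) = k + 2 → k + 2 ≤ 2 * d →
        ((fun z => ⁅f, z⁆)^[k + 1] g).coord j =
          f.coord 0 ^ k * (f.coord 0 * g.coord 1 - f.coord 1 * g.coord 0) := by
  induction k with
  | zero =>
    refine ⟨lie_mem_tail_two f g, fun j hj hk => ?_⟩
    have hd : 0 < 2 * d := by omega
    obtain rfl : j = (⟨0, hd⟩ : Fin (2 * d)).succ.succ := by ext; simpa using hj
    have h1 : mid (⟨0, hd⟩ : Fin (2 * d)) = 1 := by ext; simp [mid]
    simp only [zero_add, Function.iterate_one, bracket_succ_succ, h1]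
    rw [if_neg (by omega)]
    ring
  | succ k ih =>
    rw [Function.iterate_succ_apply']
    refine ⟨lie_mem_tail_succ ih.1 f, fun j hj hk => ?_⟩
    have hd : k + 1 < 2 * d := by omega
    obtain rfl : j = (⟨k + 1, hd⟩ : Fin (2 * d)).succ.succ := by ext; simpa using hj
    -- The bound `≤ 2 * d` keeps away from the coordinate of `x_n`, the only one that receives the
    -- brackets `[x_i, x_{n-i}]`.
    rw [bracket_succ_succ, if_neg (by simp only []; omega), ih.1 0 (by simp),
      ih.2 _ (by rw [val_mid]) (by omega)]
    ring

/-- The index of `x_{n-1}`. -/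
def penult (d : ℕ) : Fin (2 * d + 2) := ⟨2 * d, by omega⟩

theorem mem_tail_top_iff {f : QLie d} :
    f ∈ tail d (2 * d + 1) ↔ f ∈ tail d (2 * d) ∧ f.coord (penult d) = 0 := by
  refine ⟨fun h => ⟨fun j hj => h j (by omega), h _ (by simp [penult])⟩, fun h j hj => ?_⟩
  rcases Nat.lt_succ_iff_lt_or_eq.mp hj with hj | hj
  · exact h.1 j hj
  · rw [show j = penult d from Fin.ext hj]; exact h.2

/-- The operator `(ad f)^(n-2)`. -/
noncomputable def adTop (f g : QLie d) : QLie d := (fun z => ⁅f, z⁆)^[2 * d - 1] g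

theorem adTop_mem_tail (hd : 1 ≤ d) (f g : QLie d) : adTop f g ∈ tail d (2 * d) := by
  have := (ad_pow f g (2 * d - 2)).1
  rwa [show 2 * d - 2 + 1 = 2 * d - 1 by omega, show 2 * d - 2 + 2 = 2 * d by omega] at this

theorem adTop_coord (hd : 1 ≤ d) (f g : QLie d) : (adTop f g).coord (penult d) =
    f.coord 0 ^ (2 * d - 2) * (f.coord 0 * g.coord 1 - f.coord 1 * g.coord 0) := by
  have := (ad_pow f g (2 * d - 2)).2 (penult d) (by simp only [penult]; omega) (by omega)
  rwa [show 2 * d - 2 + 1 = 2 * d - 1 by omega] at this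

/-- The exponent `2 * d - 2` in the leading coordinate is positive only for `d ≥ 2`: this is where
`n > 3` is needed. -/
theorem adTop_mem_tail_top (hd : 2 ≤ d) {f : QLie d} (hf : f.coord 0 = 0) (g : QLie d) :
    adTop f g ∈ tail d (2 * d + 1) := by
  refine mem_tail_top_iff.mpr ⟨adTop_mem_tail (by omega) f g, ?_⟩
  rw [adTop_coord (by omega), hf, zero_pow (by omega), zero_mul]

theorem x_last_ne_zero : x d (Fin.last _) ≠ 0 := fun h => by
  have := congrArg (fun q => q.coord (Fin.last _)) h
  simp [x_coord] at this

/-- The diagonal map `x_0 ↦ a x_0`, `x_i ↦ a ^ i x_i`. -/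
noncomputable def scaleFun (a : ℂ) (f : QLie d) : QLie d :=
  fun k => (if k = 0 then a else a ^ (k : ℕ)) * f.coord k

theorem scaleFun_coord (a : ℂ) (f : QLie d) (k : Fin (2 * d + 2)) :
    (scaleFun a f).coord k = (if k = 0 then a else a ^ (k : ℕ)) * f.coord k := rfl

/-- Both families of brackets respect the grading with `x_0` in degree `1` and `x_i` in degree `i`
for `i ≥ 1`. -/
theorem scaleFun_lie (a : ℂ) (f g : QLie d) : scaleFun a ⁅f, g⁆ = ⁅scaleFun a f, scaleFun a g⁆ := by
  have hm (j : Fin (2 * d)) : mid j ≠ 0 := by simp [Fin.ext_iff, val_mid]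
  refine ext_coord ?_ ?_ fun j => ?_
  · simp only [scaleFun_coord, bracket_zero, mul_zero]
  · simp only [scaleFun_coord, bracket_one, mul_zero]
  · simp only [scaleFun_coord, bracket_succ_succ, hm, Fin.succ_ne_zero, if_false, if_true, val_mid,
      Fin.val_succ]
    rw [mul_add, mul_ite, Finset.mul_sum, mul_zero]
    congr 1
    · ring
    · split_ifs with h
      · refine Finset.sum_congr rfl fun i _ => ?_
        have : a ^ ((j : ℕ) + 1 + 1) = a ^ ((i : ℕ) + 1) * a ^ ((i.rev : ℕ) + 1) := by
          rw [← pow_add]; congr 1; rw [Fin.val_rev]; omega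
        rw [this]; ring
      · rfl

/-- The diagonal endomorphism `x_0 ↦ a x_0`, `x_i ↦ a ^ i x_i` of `Q_n`. -/
noncomputable def scale (d : ℕ) (a : ℂ) : QLie d →ₗ⁅ℂ⁆ QLie d where
  toFun := scaleFun a
  map_add' _ _ := coord_injective fun _ => mul_add _ _ _
  map_smul' _ _ := coord_injective fun _ => mul_left_comm _ _ _
  map_lie' {f g} := scaleFun_lie a f g

theorem scale_coord (a : ℂ) (f : QLie d) (k : Fin (2 * d + 2)) :
    (scale d a f).coord k = (if k = 0 then a else a ^ (k : ℕ)) * f.coord k := rfl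

theorem scale_coord_eq_zero {a : ℂ} (ha : a ≠ 0) (f : QLie d) (k : Fin (2 * d + 2)) :
    (scale d a f).coord k = 0 ↔ f.coord k = 0 := by
  rw [scale_coord, mul_eq_zero, or_iff_right]
  split_ifs
  exacts [ha, pow_ne_zero _ ha]

theorem scale_scale_inv {a : ℂ} (ha : a ≠ 0) (f : QLie d) : scale d a (scale d a⁻¹ f) = f := by
  refine coord_injective fun k => ?_
  rw [scale_coord, scale_coord, ← mul_assoc]
  split_ifs
  · rw [mul_inv_cancel₀ ha, one_mul]
  · rw [← mul_pow, mul_inv_cancel₀ ha, one_pow, one_mul]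

end QLie

/-! ### Central covers `Q_n^m → N` and the comparison of two of them. -/

open QLie

/-- A linear map from `Q_n^m` onto `N` that preserves brackets, whose kernel is contained in the
centre of `Q_n^m` and meets every summand trivially. -/
structure IsQCover {d m : ℕ} {N : Type*} [LieRing N] [LieAlgebra ℂ N]
    (p : (Fin m → QLie d) →ₗ[ℂ] N) : Prop where
  surjective : Function.Surjective p
  map_lie : ∀ y z : Fin m → QLie d, p (fun i => ⁅y i, z i⁆) = ⁅p y, p z⁆
  mem_tail : ∀ y, p y = 0 → ∀ i, y i ∈ tail d (2 * d + 1)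
  ne_zero : ∀ i, p (Pi.single i (x d (Fin.last _))) ≠ 0

namespace IsQCover

variable {d m : ℕ} {N : Type*} [LieRing N] [LieAlgebra ℂ N] {p q : (Fin m → QLie d) →ₗ[ℂ] N}

theorem lie_eq_zero (hp : IsQCover p) {y : Fin m → QLie d}
    (hy : ∀ i, y i ∈ tail d (2 * d + 1)) (w : N) : ⁅w, p y⁆ = 0 := by
  obtain ⟨z, rfl⟩ := hp.surjective w
  rw [← hp.map_lie, ← map_zero p]
  exact congrArg p (funext fun i => lie_eq_zero_of_mem_tail (hy i) _)

theorem map_lie_single (hp : IsQCover p) (i : Fin m) (f : QLie d) (y : Fin m → QLie d) :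
    p (Pi.single i ⁅f, y i⁆) = ⁅p (Pi.single i f), p y⁆ := by
  rw [← hp.map_lie]
  congr 1
  funext k
  rcases eq_or_ne k i with rfl | hk
  · simp
  · simp [hk]

/-- The centre of `N` is the image of the centre of `Q_n^m`. -/
theorem mem_tail_of_lie_eq_zero (hp : IsQCover p) (hd : 1 ≤ d) {y : Fin m → QLie d}
    (hy : ∀ w : N, ⁅w, p y⁆ = 0) (i : Fin m) : y i ∈ tail d (2 * d + 1) := by
  refine QLie.mem_tail_of_lie_eq_zero hd fun g => ?_
  have h : p (Pi.single i ⁅g, y i⁆) = 0 := by rw [hp.map_lie_single, hy]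
  -- The kernel forces `[g, y_i]` to be a multiple of `x_n`; as `x_n` of a single summand survives
  -- in `N`, the multiple is zero.
  have h1 := hp.mem_tail _ h i
  rw [Pi.single_eq_same, mem_tail_top] at h1
  rw [h1, Pi.single_smul, map_smul, smul_eq_zero, or_iff_left (hp.ne_zero i)] at h
  rw [h1, h, zero_smul]

/-- Being central is a property of the element of `N`, so it can be tested on a lift through either
cover. -/
theorem mem_tail_of_map_eq (hp : IsQCover p) (hq : IsQCover q) (hd : 1 ≤ d)
    {y z : Fin m → QLie d} (h : p y = q z) (hy : ∀ i, y i ∈ tail d (2 * d + 1)) (i : Fin m) :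
    z i ∈ tail d (2 * d + 1) :=
  hq.mem_tail_of_lie_eq_zero hd (fun w => by rw [← h]; exact hp.lie_eq_zero hy w) i

theorem map_iterate_lie (hp : IsQCover p) (y z : Fin m → QLie d) (k : ℕ) :
    p (fun i => (fun g => ⁅y i, g⁆)^[k] (z i)) = (fun w => ⁅p y, w⁆)^[k] (p z) := by
  induction k with
  | zero => rfl
  | succ k ih => simp only [Function.iterate_succ_apply', hp.map_lie, ← ih]

theorem map_adTop_eq (hp : IsQCover p) (hq : IsQCover q) {y z y' z' : Fin m → QLie d}
    (hy : p y = q y') (hz : p z = q z') :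
    p (fun i => adTop (y i) (z i)) = q (fun i => adTop (y' i) (z' i)) := by
  simp only [adTop, hp.map_iterate_lie, hq.map_iterate_lie, hy, hz]

/-- Vanishing of all `x_0`-coordinates makes `(ad y)^(n-2)` send `N` into its centre, a condition
independent of the cover. Testing it on `x_1` of summand `i` gives that a power of the
`x_0`-coordinate of `y i` is zero. -/
theorem coord_zero_eq_zero (hp : IsQCover p) (hq : IsQCover q) (hd : 2 ≤ d)
    {y y' : Fin m → QLie d} (h : p y = q y') (hy' : ∀ j, (y' j).coord 0 = 0) (i : Fin m) :
    (y i).coord 0 = 0 := by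
  obtain ⟨z', hz'⟩ := hq.surjective (p (Pi.single i (x d 1)))
  have h1 := hq.mem_tail_of_map_eq hp (by omega) (hp.map_adTop_eq hq h hz'.symm).symm
    (fun j => adTop_mem_tail_top hd (hy' j) _) i
  have h2 := (mem_tail_top_iff.mp h1).2
  rw [adTop_coord (by omega), Pi.single_eq_same, x_coord, x_coord, if_pos rfl,
    if_neg (by simp)] at h2
  rw [mul_zero, sub_zero, mul_one, ← pow_succ] at h2
  exact eq_zero_of_pow_eq_zero h2

/-- For `x_0` of one summand, `(ad x_0)^(n-2)` has its image on the line of `x_{n-1}` modulo the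
centre; this is transported to the cover `q`. -/
theorem exists_adTop_sub_mem_tail (hp : IsQCover p) (hq : IsQCover q) (hd : 2 ≤ d) {i : Fin m}
    {y w : Fin m → QLie d} (hy : p (Pi.single i (x d 0)) = q y)
    (hw : p (Pi.single i (x d (penult d))) = q w) (z : Fin m → QLie d) :
    ∃ t : ℂ, ∀ k, adTop (y k) (z k) - t • w k ∈ tail d (2 * d + 1) := by
  obtain ⟨z', hz'⟩ := hp.surjective (q z)
  set t := (adTop (x d 0) (z' i)).coord (penult d) with ht
  refine ⟨t, hp.mem_tail_of_map_eq hq (by omega)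
    (y := fun k => adTop ((Pi.single i (x d 0) : Fin m → QLie d) k) (z' k) -
      t • (Pi.single i (x d (penult d)) : Fin m → QLie d) k) ?_ fun k => ?_⟩
  · have h1 := map_sub p (fun k => adTop ((Pi.single i (x d 0) : Fin m → QLie d) k) (z' k))
      (t • Pi.single i (x d (penult d)))
    have h2 := map_sub q (fun k => adTop (y k) (z k)) (t • w)
    rw [hp.map_adTop_eq hq hy hz', map_smul, hw, ← map_smul, ← h2] at h1
    exact h1
  · rcases eq_or_ne k i with rfl | hk
    · rw [Pi.single_eq_same, Pi.single_eq_same, mem_tail_top_iff]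
      constructor
      · refine Submodule.sub_mem _ (adTop_mem_tail (by omega) _ _) (Submodule.smul_mem _ _ ?_)
        intro j hj
        rw [x_coord, if_neg]
        rintro rfl
        simp [penult] at hj
      · rw [sub_eq_add_neg, add_coord, neg_coord, smul_coord, x_coord, if_pos rfl, ← ht]
        ring
    · rw [Pi.single_eq_of_ne hk, Pi.single_eq_of_ne hk, smul_zero, sub_zero]
      exact adTop_mem_tail_top hd rfl _

theorem exists_smul_last (hp : IsQCover p) (hq : IsQCover q) (hd : 2 ≤ d) {i : Fin m}
    {y : Fin m → QLie d} (hy : p (Pi.single i (x d 0)) = q y) :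
    ∃ (j : Fin m) (c : ℂ), c ≠ 0 ∧ (∀ k, (y k).coord 0 ≠ 0 ↔ k = j) ∧
      p (Pi.single i (x d (Fin.last _))) = c • q (Pi.single j (x d (Fin.last _))) := by
  obtain ⟨w, hw⟩ := hq.surjective (p (Pi.single i (x d (penult d))))
  obtain ⟨j, hj⟩ : ∃ j, (y j).coord 0 ≠ 0 := by
    by_contra! h
    have := hp.coord_zero_eq_zero hq hd hy h i
    simp [x_coord] at this
  -- Applying the rank-one statement to `x_1` of summand `j` gives an element supported in that
  -- summand modulo the centre. So `w` is too, which leaves room for only one such `j`.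
  have key (j) (hj : (y j).coord 0 ≠ 0) : (∀ k, w k ∈ tail d (2 * d)) ∧
      (w j).coord (penult d) ≠ 0 ∧ ∀ k, k ≠ j → (w k).coord (penult d) = 0 := by
    obtain ⟨t, ht⟩ := hp.exists_adTop_sub_mem_tail hq hd hy hw.symm (Pi.single j (x d 1))
    have h (k) := (mem_tail_top_iff.mp (ht k)).2
    simp only [sub_eq_add_neg, add_coord, neg_coord, smul_coord,
      adTop_coord (show 1 ≤ d by omega)] at h
    have hjj := h j
    rw [Pi.single_eq_same, x_coord, x_coord, if_pos rfl, if_neg (by simp)] at hjj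
    have htw : t * (w j).coord (penult d) ≠ 0 := by
      rw [← add_neg_eq_zero.mp hjj]
      simp [hj]
    have ht0 := left_ne_zero_of_mul htw
    refine ⟨fun k => ?_, right_ne_zero_of_mul htw, fun k hk => ?_⟩
    · rw [← Submodule.smul_mem_iff _ ht0, ← Submodule.sub_mem_iff_right _
        (adTop_mem_tail (show 1 ≤ d by omega) (y k) ((Pi.single j (x d 1) : Fin m → QLie d) k))]
      exact (mem_tail_top_iff.mp (ht k)).1
    · have := h k
      rw [Pi.single_eq_of_ne hk] at this
      simpa [ht0] using this
  obtain ⟨hw1, hw2, hw3⟩ := key j hj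
  -- Use `[x_0, x_{n-1}] = x_n` in summand `i`. On the `q` side `w k` is central for `k ≠ j`, so
  -- only the bracket in summand `j` remains.
  have hlie : p (Pi.single i (x d (Fin.last _))) =
      q (Pi.single j (⁅y j, w j⁆.coord (Fin.last _) • x d (Fin.last _))) := by
    have h1 : ⁅x d 0, (Pi.single i (x d (penult d)) : Fin m → QLie d) i⁆ = x d (Fin.last _) := by
      rw [Pi.single_eq_same]
      refine x_zero_lie_x ?_ rfl
      simp only [penult, ne_eq, Fin.ext_iff, Fin.val_zero]; omega
    rw [← h1, hp.map_lie_single, hy, ← hw, ← hq.map_lie]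
    congr 1
    funext k
    rcases eq_or_ne k j with rfl | hk
    · rw [Pi.single_eq_same, h1]
      exact mem_tail_top.mp (lie_mem_tail_succ (hw1 k) _)
    · rw [Pi.single_eq_of_ne hk]
      exact lie_eq_zero_of_mem_tail (mem_tail_top_iff.mpr ⟨hw1 k, hw3 k hk⟩) _
  rw [Pi.single_smul, map_smul] at hlie
  refine ⟨j, _, fun h => hp.ne_zero i ?_, fun k => ⟨fun hk => ?_, ?_⟩, hlie⟩
  · rw [hlie, h, zero_smul]
  · by_contra hkj
    exact hw2 ((key k hk).2.2 j (Ne.symm hkj))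
  · rintro rfl
    exact hj

/-- The lines spanned by the elements `e_{in}` are permuted by a change of decomposition. -/
theorem exists_perm_smul_last (hp : IsQCover p) (hq : IsQCover q) (hd : 2 ≤ d) :
    ∃ (σ : Equiv.Perm (Fin m)) (c : Fin m → ℂ), ∀ i, c i ≠ 0 ∧
      p (Pi.single i (x d (Fin.last _))) = c i • q (Pi.single (σ i) (x d (Fin.last _))) := by
  choose y hy using fun i => hq.surjective (p (Pi.single i (x d 0)))
  choose s c hc hs hsc using fun i => hp.exists_smul_last hq hd (hy i).symm
  have hinj : Function.Injective s := by
    intro i k hik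
    by_contra hne
    have hy0 : (y k (s i)).coord 0 ≠ 0 := (hs k (s i)).mpr hik
    -- This `t` cancels the only `x_0`-coordinate that both lifts have, while the combination of the
    -- two `x_0` on the `p` side keeps coordinate `1` in summand `i`.
    set t := (y i (s i)).coord 0 / (y k (s i)).coord 0 with ht
    have h : p (Pi.single i (x d 0) + (-t) • (Pi.single k (x d 0) : Fin m → QLie d)) = q (y i + (-t) • y k) := by
      simp only [map_add, map_smul, hy]
    have := hp.coord_zero_eq_zero hq hd h (fun j => ?_) i
    · simp [Pi.single_eq_of_ne hne, x_coord] at this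
    · rw [Pi.add_apply, Pi.smul_apply, add_coord, smul_coord]
      rcases eq_or_ne j (s i) with rfl | hj
      · rw [ht]; field_simp; ring
      · rw [not_not.mp (mt (hs i j).mp hj), not_not.mp (mt (hs k j).mp (hik ▸ hj))]
        ring
  exact ⟨Equiv.ofBijective s (Finite.injective_iff_bijective.mp hinj), c, fun i => ⟨hc i, hsc i⟩⟩

theorem map_eq_sum_of_mem_tail {y : Fin m → QLie d} (hy : ∀ i, y i ∈ tail d (2 * d + 1)) :
    p y = ∑ i, (y i).coord (Fin.last _) • p (Pi.single i (x d (Fin.last _))) := by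
  have : y = ∑ i, (y i).coord (Fin.last _) • Pi.single i (x d (Fin.last _)) := by
    conv_lhs => rw [← Finset.univ_sum_single y]
    exact Finset.sum_congr rfl fun i _ => by rw [← Pi.single_smul, ← mem_tail_top.mp (hy i)]
  conv_lhs => rw [this]
  simp only [map_sum, map_smul]

/-- The kernel is encoded by the relations among the `e_{in}`; this turns the Lie problem into
linear algebra. -/
theorem map_eq_zero_iff (hp : IsQCover p) (y : Fin m → QLie d) :
    p y = 0 ↔ (∀ i, y i ∈ tail d (2 * d + 1)) ∧
      ∑ i, (y i).coord (Fin.last _) • p (Pi.single i (x d (Fin.last _))) = 0 :=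
  ⟨fun h => ⟨hp.mem_tail y h, by rw [← map_eq_sum_of_mem_tail (hp.mem_tail y h), h]⟩,
    fun h => by rw [map_eq_sum_of_mem_tail h.1, h.2]⟩

theorem exists_of_mem_lowerCentralSeries (hp : IsQCover p) (k : ℕ) :
    ∀ w ∈ LieModule.lowerCentralSeries ℂ N N (k + 1), ∃ y, (∀ i, y i ∈ tail d (k + 2)) ∧
      p y = w := by
  -- The target `S` is left free because the first bracket gains two steps of the filtration and
  -- each later one gains one.
  have aux (k : ℕ) (S : Submodule ℂ (Fin m → QLie d))
      (h : ∀ w ∈ LieModule.lowerCentralSeries ℂ N N k, ∃ y,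
        (∀ z : Fin m → QLie d, (fun i => ⁅z i, y i⁆) ∈ S) ∧ p y = w) :
      (LieModule.lowerCentralSeries ℂ N N (k + 1)).toSubmodule ≤ S.map p := by
    rw [LieModule.lowerCentralSeries_succ, LieSubmodule.lieIdeal_oper_eq_linear_span',
      Submodule.span_le]
    rintro _ ⟨v, -, w, hw, rfl⟩
    obtain ⟨y, hy, rfl⟩ := h w hw
    obtain ⟨z, rfl⟩ := hp.surjective v
    exact ⟨_, hy z, hp.map_lie z y⟩
  have hS (k : ℕ) (y : Fin m → QLie d) :
      y ∈ Submodule.pi Set.univ (fun _ => tail d k) ↔ ∀ i, y i ∈ tail d k := by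
    simp [Submodule.mem_pi]
  induction k with
  | zero =>
    intro w hw
    obtain ⟨y, hy, rfl⟩ := aux 0 (Submodule.pi Set.univ fun _ => tail d 2) (fun w _ => by
      obtain ⟨y, rfl⟩ := hp.surjective w
      exact ⟨y, fun z => (hS _ _).mpr fun i => lie_mem_tail_two _ _, rfl⟩) hw
    exact ⟨y, (hS _ _).mp hy, rfl⟩
  | succ k ih =>
    intro w hw
    obtain ⟨y, hy, rfl⟩ := aux (k + 1) (Submodule.pi Set.univ fun _ => tail d (k + 3))
      (fun w hw => by
        obtain ⟨y, hy, rfl⟩ := ih w hw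
        exact ⟨y, fun z => (hS _ _).mpr fun i => lie_mem_tail_succ (hy i) _, rfl⟩) hw
    exact ⟨y, (hS _ _).mp hy, rfl⟩

theorem single_mem_lowerCentralSeries (hp : IsQCover p) (i : Fin m) (k : ℕ)
    (hk : k + 1 < 2 * d + 2) :
    p (Pi.single i (x d ⟨k + 1, hk⟩)) ∈ LieModule.lowerCentralSeries ℂ N N k := by
  induction k with
  | zero => simp
  | succ k ih =>
    have h : ⁅x d 0, (Pi.single i (x d ⟨k + 1, by omega⟩) : Fin m → QLie d) i⁆ =
        x d ⟨k + 1 + 1, hk⟩ := by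
      rw [Pi.single_eq_same]
      exact x_zero_lie_x (by simp [Fin.ext_iff]) rfl
    rw [LieModule.lowerCentralSeries_succ, ← h, hp.map_lie_single]
    exact LieSubmodule.lie_mem_lie (LieSubmodule.mem_top _) (ih _)

theorem lowerCentralSeries_eq_span (hp : IsQCover p) (hd : 1 ≤ d) :
    (LieModule.lowerCentralSeries ℂ N N (2 * d)).toSubmodule =
      Submodule.span ℂ (Set.range fun i => p (Pi.single i (x d (Fin.last _)))) := by
  refine le_antisymm (fun w hw => ?_) (Submodule.span_le.mpr ?_)
  · obtain ⟨k, hk⟩ : ∃ k, 2 * d = k + 1 := ⟨2 * d - 1, by omega⟩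
    have hw' : w ∈ LieModule.lowerCentralSeries ℂ N N (k + 1) := by rw [← hk]; exact hw
    obtain ⟨y, hy, rfl⟩ := hp.exists_of_mem_lowerCentralSeries k w hw'
    rw [map_eq_sum_of_mem_tail (by rwa [hk])]
    exact Submodule.sum_mem _ fun i _ =>
      Submodule.smul_mem _ _ (Submodule.subset_span (Set.mem_range_self i))
  · rintro _ ⟨i, rfl⟩
    exact hp.single_mem_lowerCentralSeries i (2 * d) (by omega)

/-- The composite of a cover with an isomorphism. -/
theorem comp {N' : Type*} [LieRing N'] [LieAlgebra ℂ N'] (hp : IsQCover p) (φ : N ≃ₗ⁅ℂ⁆ N') :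
    IsQCover ((φ : N ≃ₗ[ℂ] N').toLinearMap ∘ₗ p) where
  surjective := φ.surjective.comp hp.surjective
  map_lie y z := by
    simp only [LinearMap.comp_apply, hp.map_lie]
    exact φ.map_lie _ _
  mem_tail y hy := hp.mem_tail y (by
    simp only [LinearMap.comp_apply] at hy
    exact φ.injective (hy.trans φ.map_zero.symm))
  ne_zero i hi := hp.ne_zero i (by
    simp only [LinearMap.comp_apply] at hi
    exact φ.injective (hi.trans φ.map_zero.symm))

end IsQCover

/-! ### The cover attached to a decomposition. -/

namespace QDecomposition

variable {d m : ℕ} {N : Type*} [LieRing N] [LieAlgebra ℂ N] (D : QDecomposition d m N)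

/-- The map `Q_n^m → N` given by the isomorphisms `Q_n ≅ N_i`. -/
noncomputable def cover : (Fin m → QLie d) →ₗ[ℂ] N :=
  ∑ i, (D.comp i).toSubmodule.subtype ∘ₗ (D.iso i).toLinearEquiv.toLinearMap ∘ₗ LinearMap.proj i

theorem cover_apply (y : Fin m → QLie d) : D.cover y = ∑ i, (D.iso i (y i) : N) := by
  simp only [cover, LinearMap.sum_apply]
  rfl

theorem cover_single (i : Fin m) (f : QLie d) : D.cover (Pi.single i f) = D.iso i f := by
  rw [cover_apply, Finset.sum_eq_single i, Pi.single_eq_same]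
  · intro j _ hj
    rw [Pi.single_eq_of_ne hj, map_zero]
    rfl
  · simp

theorem iso_lie_cover (i : Fin m) (f : QLie d) (y : Fin m → QLie d) :
    ⁅(D.iso i f : N), D.cover y⁆ = D.iso i ⁅f, y i⁆ := by
  rw [cover_apply, lie_sum, Finset.sum_eq_single i]
  · rw [LieEquiv.map_lie]
    rfl
  · exact fun j _ hj => D.comm i j hj.symm _ (D.iso i f).2 _ (D.iso j (y j)).2
  · simp

theorem isQCover_cover (hd : 1 ≤ d) : IsQCover D.cover where
  surjective := by
    rw [← LinearMap.range_eq_top, eq_top_iff, ← D.iSup_comp, iSup_le_iff]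
    intro i w hw
    refine ⟨Pi.single i ((D.iso i).symm ⟨w, hw⟩), ?_⟩
    rw [cover_single, LieEquiv.apply_symm_apply]
  map_lie y z := by
    rw [cover_apply, D.cover_apply y, sum_lie]
    exact Finset.sum_congr rfl fun i _ => (D.iso_lie_cover i (y i) z).symm
  mem_tail y hy i := by
    -- Bracketing `D.cover y = 0` with `N_i` sees only the component `y i`, which must therefore be
    -- central in `Q_n`.
    refine mem_tail_of_lie_eq_zero hd fun g => (D.iso i).injective (Subtype.ext ?_)
    change (D.iso i ⁅g, y i⁆ : N) = D.iso i 0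
    rw [← iso_lie_cover, hy, lie_zero, map_zero]
    rfl
  ne_zero i hi := by
    rw [cover_single] at hi
    refine x_last_ne_zero ((D.iso i).injective (Subtype.ext ?_))
    change (D.iso i (x d (Fin.last _)) : N) = D.iso i 0
    rw [hi, map_zero]
    rfl

theorem e_last (i : Fin m) :
    D.e i (Fin.last _) = D.cover (Pi.single i (x d (Fin.last _))) := by
  rw [cover_single, QDecomposition.e, QLie.e, if_neg (by simp [Fin.ext_iff])]

end QDecomposition

/-! ### Linear algebra of related and monomial matrices. -/

/-- The splitting of the columns of a related matrix into two blocks. -/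
def blockEquiv {m r : ℕ} (h : r ≤ m) : Fin r ⊕ Fin (m - r) ≃ Fin m :=
  finSumFinEquiv.trans (finCongr (Nat.add_sub_cancel' h))

theorem blockMatrix_inr {m r : ℕ} (h : r ≤ m) (A : Matrix (Fin (m - r)) (Fin r) ℂ)
    (i j : Fin (m - r)) :
    blockMatrix A i (blockEquiv h (Sum.inr j)) = if j = i then 1 else 0 := by
  simp [blockMatrix, blockEquiv, Fin.ext_iff]

/-- The identity block lets `u` be read off from its combination of rows. -/
theorem vecMul_blockMatrix_inr {m r : ℕ} (h : r ≤ m) (A : Matrix (Fin (m - r)) (Fin r) ℂ)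
    (u : Fin (m - r) → ℂ) (j : Fin (m - r)) :
    Matrix.vecMul u (blockMatrix A) (blockEquiv h (Sum.inr j)) = u j := by
  simp [Matrix.vecMul, dotProduct, blockMatrix_inr]

/-- If the rows of `(A I)` are relations between vectors that span an `r`-dimensional space,
they span the space of all relations. -/
theorem sum_smul_eq_zero_iff_vecMul_blockMatrix {m r : ℕ} {V : Type*} [AddCommGroup V]
    [Module ℂ V] (h : r ≤ m) (v : Fin m → V)
    (hv : Module.finrank ℂ (Submodule.span ℂ (Set.range v)) = r)
    (A : Matrix (Fin (m - r)) (Fin r) ℂ) (hA : ∀ i, ∑ j, blockMatrix A i j • v j = 0)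
    (a : Fin m → ℂ) :
    ∑ j, a j • v j = 0 ↔ ∃ u : Fin (m - r) → ℂ, Matrix.vecMul u (blockMatrix A) = a := by
  have hsum (u : Fin (m - r) → ℂ) : ∑ j, Matrix.vecMul u (blockMatrix A) j • v j = 0 := by
    simp only [Matrix.vecMul, dotProduct, Finset.sum_smul, mul_smul]
    rw [Finset.sum_comm]
    simp only [← Finset.smul_sum, hA, smul_zero, Finset.sum_const_zero]
  have hsplit (a : Fin m → ℂ) : ∑ j, a j • v j =
      ∑ j, a (blockEquiv h (Sum.inl j)) • v (blockEquiv h (Sum.inl j)) +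
        ∑ j, a (blockEquiv h (Sum.inr j)) • v (blockEquiv h (Sum.inr j)) := by
    rw [← Equiv.sum_comp (blockEquiv h), Fintype.sum_sum_type]
  -- Each row expresses one of the last `m - r` vectors through the first `r`. These therefore span
  -- a space of dimension `r` and are independent.
  have hli : LinearIndependent ℂ fun j : Fin r => v (blockEquiv h (Sum.inl j)) := by
    have hspan : Submodule.span ℂ (Set.range v) =
        Submodule.span ℂ (Set.range fun j : Fin r => v (blockEquiv h (Sum.inl j))) := by
      refine le_antisymm (Submodule.span_le.mpr ?_) (Submodule.span_mono ?_)
      · rintro _ ⟨k, rfl⟩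
        obtain ⟨k, rfl⟩ := (blockEquiv h).surjective k
        rcases k with k | k
        · exact Submodule.subset_span ⟨k, rfl⟩
        · have hk := hA k
          rw [hsplit] at hk
          simp only [blockMatrix_inr, ite_smul, one_smul, zero_smul, Finset.sum_ite_eq',
            Finset.mem_univ, if_true] at hk
          rw [SetLike.mem_coe, eq_neg_of_add_eq_zero_right hk]
          exact Submodule.neg_mem _ (Submodule.sum_mem _ fun j _ =>
            Submodule.smul_mem _ _ (Submodule.subset_span ⟨j, rfl⟩))
      · rintro _ ⟨j, rfl⟩
        exact ⟨_, rfl⟩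
    rw [linearIndependent_iff_card_eq_finrank_span, Fintype.card_fin, Set.finrank, ← hspan, hv]
  refine ⟨fun ha => ?_, fun ⟨u, hu⟩ => hu ▸ hsum u⟩
  -- The identity block forces this `u`; the difference from `a` is then a relation among the first
  -- `r` vectors only.
  set u : Fin (m - r) → ℂ := fun j => a (blockEquiv h (Sum.inr j)) with hu
  refine ⟨u, funext fun k => ?_⟩
  have h1 := ha.trans (hsum u).symm
  rw [hsplit, hsplit (Matrix.vecMul u (blockMatrix A))] at h1
  simp only [vecMul_blockMatrix_inr, hu, add_left_inj] at h1
  rw [← sub_eq_zero, ← Finset.sum_sub_distrib] at h1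
  simp only [← sub_smul] at h1
  have h2 := Fintype.linearIndependent_iff.mp hli _ h1
  obtain ⟨k, rfl⟩ := (blockEquiv h).surjective k
  rcases k with k | k
  · exact (sub_eq_zero.mp (h2 k)).symm
  · rw [vecMul_blockMatrix_inr]

/-- The monomial matrix of a permutation and a family of scalars. -/
def monomialMatrix {m : ℕ} (σ : Equiv.Perm (Fin m)) (c : Fin m → ℂ) : Matrix (Fin m) (Fin m) ℂ :=
  Matrix.of fun i j => if j = σ i then c i else 0

theorem isMonomialMatrix_iff {m : ℕ} {K : Matrix (Fin m) (Fin m) ℂ} :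
    IsMonomialMatrix K ↔
      ∃ (σ : Equiv.Perm (Fin m)) (c : Fin m → ℂ), (∀ i, c i ≠ 0) ∧ K = monomialMatrix σ c := by
  constructor
  · rintro ⟨hr, hc⟩
    choose s hs hs' using hr
    have hinj : Function.Injective s := fun i j hij =>
      (hc (s i)).unique (hs i) (hij ▸ hs j)
    refine ⟨Equiv.ofBijective s (Finite.injective_iff_bijective.mp hinj), fun i => K i (s i),
      hs, ?_⟩
    ext i j
    simp only [monomialMatrix, Matrix.of_apply, Equiv.ofBijective_apply]
    split_ifs with h
    · rw [h]
    · by_contra h1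
      exact h (hs' i j h1)
  · rintro ⟨σ, c, hc, rfl⟩
    refine ⟨fun i => ⟨σ i, by simp [monomialMatrix, hc], fun j hj => ?_⟩,
      fun j => ⟨σ.symm j, by simp [monomialMatrix, hc], fun i hi => ?_⟩⟩
    · by_contra h
      simp [monomialMatrix, h] at hj
    · by_contra h
      have : j ≠ σ i := fun h' => h (by rw [h', Equiv.symm_apply_apply])
      simp [monomialMatrix, this] at hi

theorem vecMul_monomialMatrix {m : ℕ} (σ : Equiv.Perm (Fin m)) (c a : Fin m → ℂ) (i : Fin m) :
    Matrix.vecMul a (monomialMatrix σ c) (σ i) = a i * c i := by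
  simp [Matrix.vecMul, dotProduct, monomialMatrix]

/-! ### Isomorphisms from matching kernels. -/

/-- Two bracket preserving surjections with the same kernel have isomorphic images. -/
theorem nonempty_lieEquiv_of_ker_eq {d m : ℕ} {N N' : Type*} [LieRing N] [LieAlgebra ℂ N]
    [LieRing N'] [LieAlgebra ℂ N'] {p : (Fin m → QLie d) →ₗ[ℂ] N}
    {q : (Fin m → QLie d) →ₗ[ℂ] N'} (hp : Function.Surjective p) (hq : Function.Surjective q)
    (hp' : ∀ y z : Fin m → QLie d, p (fun i => ⁅y i, z i⁆) = ⁅p y, p z⁆)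
    (hq' : ∀ y z : Fin m → QLie d, q (fun i => ⁅y i, z i⁆) = ⁅q y, q z⁆)
    (hker : ∀ y, p y = 0 ↔ q y = 0) : Nonempty (N ≃ₗ⁅ℂ⁆ N') := by
  have hpq (y z) : p y = p z ↔ q y = q z := by
    rw [← sub_eq_zero, ← map_sub, hker, map_sub, sub_eq_zero]
  have key (y) : q (Function.surjInv hp (p y)) = q y :=
    (hpq _ _).mp (Function.surjInv_eq hp (p y))
  let f : N →ₗ⁅ℂ⁆ N' :=
    { toFun := fun w => q (Function.surjInv hp w)
      map_add' := fun v w => by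
        obtain ⟨y, rfl⟩ := hp v
        obtain ⟨z, rfl⟩ := hp w
        rw [← map_add, key, key, key, map_add]
      map_smul' := fun c v => by
        obtain ⟨y, rfl⟩ := hp v
        rw [← map_smul, key, key, map_smul, RingHom.id_apply]
      map_lie' := fun {v w} => by
        obtain ⟨y, rfl⟩ := hp v
        obtain ⟨z, rfl⟩ := hp w
        simp only [← hp', key, hq'] }
  have hf (y) : f (p y) = q y := key y
  refine ⟨LieEquiv.ofBijective f ⟨fun v w h => ?_, fun w => ?_⟩⟩
  · obtain ⟨y, rfl⟩ := hp v
    obtain ⟨z, rfl⟩ := hp w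
    rw [hf, hf] at h
    exact (hpq y z).mpr h
  · obtain ⟨y, rfl⟩ := hq w
    exact ⟨p y, hf y⟩

/-- The map `Q_n^m → Q_n^m` that scales the `i`-th summand and moves it to position `σ i`. -/
noncomputable def permScale (d : ℕ) {m : ℕ} (σ : Equiv.Perm (Fin m)) (a : Fin m → ℂ) :
    (Fin m → QLie d) →ₗ[ℂ] (Fin m → QLie d) :=
  LinearMap.pi fun j => (scale d (a (σ.symm j)) : QLie d →ₗ[ℂ] QLie d) ∘ₗ
    LinearMap.proj (σ.symm j)

theorem permScale_apply {d m : ℕ} (σ : Equiv.Perm (Fin m)) (a : Fin m → ℂ) (y : Fin m → QLie d)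
    (i : Fin m) : permScale d σ a y (σ i) = scale d (a i) (y i) := by
  simp [permScale]

theorem permScale_surjective {d m : ℕ} (σ : Equiv.Perm (Fin m)) {a : Fin m → ℂ}
    (ha : ∀ i, a i ≠ 0) : Function.Surjective (permScale d σ a) := by
  intro y
  refine ⟨fun i => scale d (a i)⁻¹ (y (σ i)), funext fun j => ?_⟩
  obtain ⟨i, rfl⟩ := σ.surjective j
  rw [permScale_apply, scale_scale_inv (ha i)]

theorem permScale_lie {d m : ℕ} (σ : Equiv.Perm (Fin m)) (a : Fin m → ℂ) (y z : Fin m → QLie d) :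
    permScale d σ a (fun i => ⁅y i, z i⁆) =
      fun i => ⁅permScale d σ a y i, permScale d σ a z i⁆ := by
  funext j
  obtain ⟨i, rfl⟩ := σ.surjective j
  simp only [permScale_apply, LieHom.map_lie]

theorem IsQCover.nonempty_lieEquiv {d m : ℕ} {N N' : Type*} [LieRing N] [LieAlgebra ℂ N]
    [LieRing N'] [LieAlgebra ℂ N'] {p : (Fin m → QLie d) →ₗ[ℂ] N}
    {q : (Fin m → QLie d) →ₗ[ℂ] N'} (hp : IsQCover p) (hq : IsQCover q)
    (σ : Equiv.Perm (Fin m)) {c : Fin m → ℂ} (hc : ∀ i, c i ≠ 0)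
    (h : ∀ v : Fin m → ℂ, ∑ i, v i • p (Pi.single i (x d (Fin.last _))) = 0 ↔
      ∑ i, (v i * c i) • q (Pi.single (σ i) (x d (Fin.last _))) = 0) :
    Nonempty (N ≃ₗ⁅ℂ⁆ N') := by
  -- The diagonal map with parameter `a` multiplies `x_n` by `a ^ n`, so an `n`-th root of `c i` is
  -- required.
  choose a ha using fun i => IsAlgClosed.exists_pow_nat_eq (c i) (Nat.succ_pos (2 * d))
  have ha0 (i) : a i ≠ 0 := fun h0 => hc i (by rw [← ha, h0, zero_pow (Nat.succ_ne_zero _)])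
  refine nonempty_lieEquiv_of_ker_eq hp.surjective
    (q := q ∘ₗ permScale d σ a) (hq.surjective.comp (permScale_surjective σ ha0)) hp.map_lie
    (fun y z => ?_) fun y => ?_
  · simp only [LinearMap.comp_apply, permScale_lie, hq.map_lie]
  · rw [LinearMap.comp_apply, hp.map_eq_zero_iff, hq.map_eq_zero_iff, h]
    rw [← Equiv.sum_comp σ fun i => (permScale d σ a y i).coord (Fin.last _) •
        q (Pi.single i (x d (Fin.last _))), ← σ.forall_congr_right
      (q := fun i => permScale d σ a y i ∈ tail d (2 * d + 1))]
    have hlast (i) : (scale d (a i) (y i)).coord (Fin.last _) =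
        (y i).coord (Fin.last _) * c i := by
      rw [scale_coord, if_neg (by simp), mul_comm, ← ha, Fin.val_last]
    simp only [permScale_apply, hlast, QLie.mem_tail, scale_coord_eq_zero (ha0 _)]

/-! ### The classification. -/

theorem theorem3p1 (d m r : ℕ) (hd : 2 ≤ d)
    {N₁ N₂ : Type*} [LieRing N₁] [LieAlgebra ℂ N₁] [LieRing N₂] [LieAlgebra ℂ N₂]
    (hN₁ : IsQuasiQFiliform d m r N₁) (hN₂ : IsQuasiQFiliform d m r N₂)
    (A₁ A₂ : Matrix (Fin (m - r)) (Fin r) ℂ)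
    (hA₁ : IsRelatedMatrix d N₁ A₁) (hA₂ : IsRelatedMatrix d N₂ A₂) :
    Nonempty (N₁ ≃ₗ⁅ℂ⁆ N₂) ↔
      ∃ (E : Matrix (Fin (m - r)) (Fin (m - r)) ℂ) (K : Matrix (Fin m) (Fin m) ℂ),
        IsUnit E ∧ IsMonomialMatrix K ∧ E * blockMatrix A₁ * K = blockMatrix A₂ := by
  obtain ⟨D₁, hD₁⟩ := hA₁
  obtain ⟨D₂, hD₂⟩ := hA₂
  have hp := D₁.isQCover_cover (by omega)
  have hq := D₂.isQCover_cover (by omega)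
  have hf₁ := hN₁.2
  have hf₂ := hN₂.2
  change Module.finrank ℂ (LieModule.lowerCentralSeries ℂ N₁ N₁ (2 * d)).toSubmodule = r at hf₁
  change Module.finrank ℂ (LieModule.lowerCentralSeries ℂ N₂ N₂ (2 * d)).toSubmodule = r at hf₂
  rw [hp.lowerCentralSeries_eq_span (by omega)] at hf₁
  rw [hq.lowerCentralSeries_eq_span (by omega)] at hf₂
  have hr : r ≤ m := by
    rw [← hf₁]
    exact (finrank_range_le_card _).trans_eq (Fintype.card_fin m)
  simp only [QDecomposition.e_last] at hD₁ hD₂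
  have hR₁ := sum_smul_eq_zero_iff_vecMul_blockMatrix hr _ hf₁ A₁ hD₁
  have hR₂ := sum_smul_eq_zero_iff_vecMul_blockMatrix hr _ hf₂ A₂ hD₂
  constructor
  · rintro ⟨φ⟩
    obtain ⟨σ, c, hc⟩ := (hp.comp φ).exists_perm_smul_last hq hd
    have hφ (i) : φ (D₁.cover (Pi.single i (x d (Fin.last _)))) =
      c i • D₂.cover (Pi.single (σ i) (x d (Fin.last _))) := (hc i).2
    -- Pulled back along `φ`, each row of the second matrix is a relation in `N₁`, hence a
    -- combination of rows of the first; the coefficients form `E`.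
    have hrow (i : Fin (m - r)) :
        ∃ u, Matrix.vecMul u (blockMatrix A₁) = fun k => blockMatrix A₂ i (σ k) / c k := by
      rw [← hR₁]
      apply φ.injective
      rw [map_sum, map_zero, ← hD₂ i,
        ← Equiv.sum_comp σ fun j => blockMatrix A₂ i j • D₂.cover (Pi.single j _)]
      refine Finset.sum_congr rfl fun k _ => ?_
      change φ _ = _
      rw [map_smul, hφ, smul_smul, div_mul_cancel₀ _ (hc k).1]
    choose E hE using hrow
    have hEK : Matrix.of E * blockMatrix A₁ * monomialMatrix σ c = blockMatrix A₂ := by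
      ext i j
      obtain ⟨k, rfl⟩ := σ.surjective j
      rw [Matrix.mul_apply_eq_vecMul, vecMul_monomialMatrix, Matrix.mul_apply_eq_vecMul]
      change Matrix.vecMul (E i) _ k * _ = _
      rw [hE, div_mul_cancel₀ _ (hc k).1]
    refine ⟨Matrix.of E, monomialMatrix σ c, ?_,
      isMonomialMatrix_iff.mpr ⟨σ, c, fun i => (hc i).1, rfl⟩, hEK⟩
    -- If `u` and `v` agree after `E`, they give the same combination of rows of the second matrix,
    -- and its identity block yields `u = v`.
    rw [← Matrix.vecMul_injective_iff_isUnit]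
    intro u v huv
    have h : Matrix.vecMul u (blockMatrix A₂) = Matrix.vecMul v (blockMatrix A₂) := by
      simp only [← hEK, ← Matrix.vecMul_vecMul]
      exact congrArg (fun w => Matrix.vecMul (Matrix.vecMul w _) _) huv
    funext j
    rw [← vecMul_blockMatrix_inr hr A₂ u, h, vecMul_blockMatrix_inr]
  · rintro ⟨E, K, hE, hK, hEK⟩
    obtain ⟨σ, c, hc, rfl⟩ := isMonomialMatrix_iff.mp hK
    refine hp.nonempty_lieEquiv hq σ hc fun v => ?_
    have hv : ∑ i, (v i * c i) • D₂.cover (Pi.single (σ i) (x d (Fin.last _))) =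
        ∑ j, Matrix.vecMul v (monomialMatrix σ c) j •
          D₂.cover (Pi.single j (x d (Fin.last _))) := by
      rw [← Equiv.sum_comp σ fun j => Matrix.vecMul v (monomialMatrix σ c) j •
        D₂.cover (Pi.single j (x d (Fin.last _)))]
      simp only [vecMul_monomialMatrix]
    -- It remains to see that `v` lies in the row space of the first matrix exactly when `v K` lies
    -- in that of the second.
    rw [hv, hR₁, hR₂]
    constructor
    · rintro ⟨u, rfl⟩
      obtain ⟨w, rfl⟩ := Matrix.vecMul_surjective_iff_isUnit.mpr hE u
      exact ⟨w, by rw [← hEK, Matrix.mul_assoc, Matrix.vecMul_vecMul,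
        Matrix.vecMul_vecMul]⟩
    · rintro ⟨w, hw⟩
      refine ⟨Matrix.vecMul w E, funext fun i => mul_right_cancel₀ (hc i) ?_⟩
      rw [← vecMul_monomialMatrix σ c v, ← hw, ← vecMul_monomialMatrix σ c, ← hEK,
        Matrix.vecMul_vecMul, Matrix.vecMul_vecMul, Matrix.mul_assoc]
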